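/- Let $H$ be a real Hilbert space and let $F:H\to H$ be continuous and monotone, i.e. $\langle F(u)-F(v),u-v\rangle\ge 0$ for all $u,v\in H$. Suppose that the equation $F(u)=f$ is solvable and let $y$ be its minimal-norm solution. Let $0<\gamma<1$, $\theta>0$ and $0<C_1<C_2$ be constants. Let $D\subseteq(0,\infty)$ be a set of noise levels (for example $D=(0,1)$) and suppose that for every $\delta\in D$ we are given noisy data $f_\delta\in H$ with $\|f_\delta-f\|\le\delta$, an element $v_\delta\in H$ and a number $\alpha(\delta)>0$ such that $$\|F(v_\delta)+\alpha(\delta)v_\delta-f_\delta\|\le\theta\delta \qquad\text{and}\qquad C_1\delta^\gamma\le\|F(v_\delta)-f_\delta\|\le C_2\delta^\gamma .$$ Then $$\lim_{\delta\to 0,\ \delta\in D}\|v_\delta-y\|=0 .$$ -/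

import Mathlib

open Filter Topology

/-- A (possibly nonlinear) operator `F : H → H` on a real Hilbert space is monotone if
`⟨F u - F v, u - v⟩ ≥ 0` for all `u, v`. -/
def IsMonotoneOperator {H : Type*} [NormedAddCommGroup H] [InnerProductSpace ℝ H]
    (F : H → H) : Prop :=
  ∀ u v : H, 0 ≤ inner ℝ (F u - F v) (u - v)

/-- `y` is a minimal-norm solution of the equation `F u = f`. -/
def IsMinimalNormSolution {H : Type*} [NormedAddCommGroup H]
    (F : H → H) (f y : H) : Prop :=
  F y = f ∧ ∀ u : H, F u = f → ‖y‖ ≤ ‖u‖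

/-!
Testing monotonicity of `F` at the approximate solution `w = v δ` and the minimal-norm solution `y`
gives `α ⟪w, w - y⟫ ≤ (θ + 1) δ ‖w - y‖`. The lower discrepancy bound forces `α ‖w‖` to be at least
of the order of `δ ^ γ`, so the right-hand side is at most `ε α ‖w‖ ‖w - y‖` with `ε` a multiple of
`δ ^ (1 - γ)`. Cancelling `α ‖w‖` leaves `‖w‖ ≤ (1 + ε) / (1 - ε) * ‖y‖`
(`norm_le_of_inner_sub_le`), so asymptotically `w` is no longer than `y`. The upper discrepancy
bound gives `F (v δ) → f`.

These two facts already imply strong convergence (`tendsto_norm_sub_of_norm_le`). Along any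
ultrafilter the bounded family `v` converges weakly to some `u`, by Banach-Alaoglu. Monotonicity
passes to this limit, so `⟪F z - f, z - u⟫ ≥ 0` for all `z`, and Minty's trick turns this into
`F u = f`. Weak lower semicontinuity of the norm gives `‖u‖ ≤ ‖y‖`. The solution set is convex,
again by Minty, so the minimal-norm solution is unique and `u = y`. Finally weak convergence to `y`
together with `limsup ‖v‖ ≤ ‖y‖` is strong convergence.
-/

section Monotone

variable {H : Type*} [NormedAddCommGroup H] [InnerProductSpace ℝ H]

/-- **Minty's trick**: for continuous `F`, the variational inequality with the operator evaluated
at the test point already characterises solutions of `F u = f`. -/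
lemma eq_of_forall_inner_sub_nonneg {F : H → H} (hF : Continuous F) {f u : H}
    (h : ∀ z, 0 ≤ inner ℝ (F z - f) (z - u)) : F u = f := by
  have key : ∀ x, 0 ≤ inner ℝ (F u - f) x := by
    intro x
    have hc : Continuous fun t : ℝ => inner ℝ (F (u + t • x) - f) x := by fun_prop
    have ht : Tendsto (fun t : ℝ => inner ℝ (F (u + t • x) - f) x) (𝓝[>] 0)
        (𝓝 (inner ℝ (F u - f) x)) := by
      simpa using (hc.tendsto 0).mono_left nhdsWithin_le_nhds
    refine ge_of_tendsto ht ?_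
    filter_upwards [self_mem_nhdsWithin] with t (ht0 : 0 < t)
    have := h (u + t • x)
    rw [add_sub_cancel_left, inner_smul_right] at this
    exact nonneg_of_mul_nonneg_right this ht0
  have h1 := key (-(F u - f))
  rw [inner_neg_right, real_inner_self_eq_norm_sq] at h1
  have h2 : ‖F u - f‖ = 0 := by nlinarith [norm_nonneg (F u - f)]
  exact sub_eq_zero.mp (norm_eq_zero.mp h2)

/-- Uniqueness of the minimal-norm solution. The midpoint of two solutions is again a solution, by
Minty's trick, and strict convexity of the norm does the rest. -/
lemma IsMinimalNormSolution.eq_of_norm_le {F : H → H} (hF : Continuous F)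
    (hmono : IsMonotoneOperator F) {f y u : H} (hy : IsMinimalNormSolution F f y)
    (hu : F u = f) (hle : ‖u‖ ≤ ‖y‖) : u = y := by
  have hm : F ((2⁻¹ : ℝ) • (u + y)) = f := by
    refine eq_of_forall_inner_sub_nonneg hF fun z => ?_
    have h1 := hmono z u
    have h2 := hmono z y
    rw [hu] at h1
    rw [hy.1] at h2
    have e : z - (2⁻¹ : ℝ) • (u + y) = (2⁻¹ : ℝ) • ((z - u) + (z - y)) := by module
    rw [e, inner_smul_right, inner_add_right]
    linarith
  have h1 := hy.2 _ hm
  rw [norm_smul, Real.norm_of_nonneg (by norm_num)] at h1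
  have h2 := parallelogram_law_with_norm ℝ u y
  have h3 : ‖u - y‖ = 0 := by
    nlinarith [norm_nonneg (u - y), norm_nonneg u, norm_nonneg y, norm_nonneg (u + y)]
  exact sub_eq_zero.mp (norm_eq_zero.mp h3)

/-- Bounded families in a Hilbert space converge weakly along ultrafilters. -/
lemma Ultrafilter.exists_tendsto_inner_of_norm_le [CompleteSpace H] {ι : Type*}
    (U : Ultrafilter ι) {v : ι → H} {R : ℝ} (hv : ∀ᶠ i in U, ‖v i‖ ≤ R) :
    ∃ u : H, ∀ x, Tendsto (fun i => inner ℝ (v i) x) U (𝓝 (inner ℝ u x)) := by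
  let T : ι → WeakDual ℝ H := fun i => StrongDual.toWeakDual (InnerProductSpace.toDual ℝ H (v i))
  have hK := WeakDual.isCompact_closedBall (𝕜 := ℝ) (0 : StrongDual ℝ H) R
  obtain ⟨φ, -, hφ⟩ := hK.ultrafilter_le_nhds (U.map T) (by
    rw [Ultrafilter.coe_map, le_principal_iff, Filter.mem_map]
    filter_upwards [hv] with i hi
    simpa [T, dist_eq_norm] using hi)
  refine ⟨(InnerProductSpace.toDual ℝ H).symm (WeakDual.toStrongDual φ), fun x => ?_⟩
  have h := ((WeakDual.eval_continuous (𝕜 := ℝ) x).tendsto φ).comp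
    (show Tendsto T U (𝓝 φ) from hφ)
  rw [InnerProductSpace.toDual_symm_apply]
  exact h

/-- Any family of approximate solutions whose norms are asymptotically at most that of the
minimal-norm solution converges to it strongly. -/
lemma tendsto_norm_sub_of_norm_le [CompleteSpace H] {F : H → H} (hF : Continuous F)
    (hmono : IsMonotoneOperator F) {f y : H} (hy : IsMinimalNormSolution F f y)
    {ι : Type*} {l : Filter ι} {v : ι → H} {ρ : ι → ℝ} (hρ : Tendsto ρ l (𝓝 ‖y‖))
    (hv : ∀ᶠ i in l, ‖v i‖ ≤ ρ i) (hFv : Tendsto (fun i => F (v i)) l (𝓝 f)) :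
    Tendsto (fun i => ‖v i - y‖) l (𝓝 0) := by
  rw [tendsto_iff_ultrafilter]
  intro U hU
  have hρ := hρ.mono_left hU
  have hv := hv.filter_mono hU
  have hFv := hFv.mono_left hU
  have hbdd : ∀ᶠ i in (U : Filter ι), ‖v i‖ ≤ ‖y‖ + 1 := by
    filter_upwards [hv, hρ.eventually_le_const (lt_add_one ‖y‖)] with i h1 h2
    exact h1.trans h2
  obtain ⟨u, hu⟩ := U.exists_tendsto_inner_of_norm_le hbdd
  have hsol : F u = f := by
    refine eq_of_forall_inner_sub_nonneg hF fun z => ?_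
    -- `F (v i) - f` is strongly null and `z - v i` is bounded, so `F (v i)` may be replaced by `f`.
    have h0 : Tendsto (fun i => inner ℝ (F (v i) - f) (z - v i)) U (𝓝 0) := by
      have hn : Tendsto (fun i => ‖F (v i) - f‖ * (‖z‖ + (‖y‖ + 1))) U (𝓝 0) := by
        simpa using (tendsto_iff_norm_sub_tendsto_zero.mp hFv).mul_const (‖z‖ + (‖y‖ + 1))
      refine squeeze_zero_norm' ?_ hn
      filter_upwards [hbdd] with i hi
      refine (norm_inner_le_norm _ _).trans (mul_le_mul_of_nonneg_left ?_ (norm_nonneg _))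
      exact (norm_sub_le _ _).trans (by linarith)
    have h1 : Tendsto (fun i => inner ℝ (F z - f) (z - v i)) U
        (𝓝 (inner ℝ (F z - f) (z - u))) := by
      have := (hu (F z - f)).const_sub (inner ℝ (F z - f) z)
      simpa only [inner_sub_right, real_inner_comm (F z - f)] using this
    have h2 := h1.sub h0
    rw [sub_zero] at h2
    refine ge_of_tendsto' h2 fun i => ?_
    rw [← inner_sub_left, sub_sub_sub_cancel_right]
    exact hmono z (v i)
  have hnorm : ‖u‖ ≤ ‖y‖ := by
    have h := le_of_tendsto_of_tendsto (hu u) (hρ.mul_const ‖u‖) (by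
      filter_upwards [hv] with i hi
      exact (real_inner_le_norm _ _).trans (mul_le_mul_of_nonneg_right hi (norm_nonneg _)))
    rw [real_inner_self_eq_norm_sq] at h
    by_contra! hlt
    nlinarith [norm_nonneg y]
  obtain rfl : u = y := hy.eq_of_norm_le hF hmono hsol hnorm
  have hsq : Tendsto (fun i => ‖v i - u‖ ^ 2) U (𝓝 0) := by
    have hlim : Tendsto (fun i => ρ i ^ 2 - 2 * inner ℝ (v i) u + ‖u‖ ^ 2) U (𝓝 0) := by
      have := ((hρ.pow 2).sub ((hu u).const_mul 2)).add_const (‖u‖ ^ 2)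
      rw [real_inner_self_eq_norm_sq] at this
      convert this using 2
      ring
    refine squeeze_zero' (Eventually.of_forall fun i => sq_nonneg _) ?_ hlim
    filter_upwards [hv] with i hi
    rw [norm_sub_sq_real]
    gcongr
  simpa using hsq.sqrt

/-- The a priori bound: an element almost orthogonal to its difference from `y`, or at an obtuse
angle to it, is not much longer than `y`. -/
lemma norm_le_of_inner_sub_le {w y : H} {ε : ℝ} (hε0 : 0 ≤ ε) (hε1 : ε < 1)
    (h : inner ℝ w (w - y) ≤ ε * ‖w‖ * ‖w - y‖) : ‖w‖ ≤ (1 + ε) / (1 - ε) * ‖y‖ := by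
  rw [div_mul_eq_mul_div, le_div_iff₀ (by linarith)]
  rcases (norm_nonneg w).eq_or_lt with hw | hw
  · rw [← hw, zero_mul]
    positivity
  · have h1 : ε * ‖w‖ * ‖w - y‖ ≤ ε * ‖w‖ * (‖w‖ + ‖y‖) := by
      gcongr
      exact norm_sub_le _ _
    rw [inner_sub_right, real_inner_self_eq_norm_sq] at h
    have h2 := real_inner_le_norm w y
    refine le_of_mul_le_mul_left ?_ hw
    nlinarith

/-- Monotonicity combined with the discrepancy lower bound `c ≤ α ‖w‖`: the noise level `η`,
measured relative to `c`, controls the angle between `w` and `w - y`. -/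
lemma IsMonotoneOperator.inner_sub_le {F : H → H} (hmono : IsMonotoneOperator F) {w y g : H}
    {a c ε η : ℝ} (ha : 0 < a) (hε : 0 ≤ ε) (hη : η ≤ ε * c)
    (hc : c ≤ ‖a • w‖) (hres : ‖F w + a • w - g‖ + ‖g - F y‖ ≤ η) :
    inner ℝ w (w - y) ≤ ε * ‖w‖ * ‖w - y‖ := by
  have h1 := hmono w y
  have e : F w - F y = (F w + a • w - g) + (g - F y) - a • w := by abel
  rw [e, inner_sub_left, real_inner_smul_left] at h1
  have h2 := real_inner_le_norm ((F w + a • w - g) + (g - F y)) (w - y)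
  have h3 : ‖(F w + a • w - g) + (g - F y)‖ ≤ ε * (a * ‖w‖) := by
    rw [norm_smul, Real.norm_of_nonneg ha.le] at hc
    exact (norm_add_le _ _).trans (hres.trans (hη.trans (mul_le_mul_of_nonneg_left hc hε)))
  have h4 := mul_le_mul_of_nonneg_right h3 (norm_nonneg (w - y))
  refine le_of_mul_le_mul_left ?_ ha
  linarith

end Monotone

/-- `D` is the set of noise levels under consideration, e.g. `D = (0, 1)` or
`D = {δ₀, δ₁, …}` for a sequence of positive noise levels. -/
theorem theorem2 {H : Type*} [NormedAddCommGroup H] [InnerProductSpace ℝ H] [CompleteSpace H]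
    (F : H → H) (hF_cont : Continuous F) (hF_mono : IsMonotoneOperator F)
    (f y : H) (hy : IsMinimalNormSolution F f y)
    (γ θ C₁ C₂ : ℝ) (hγ0 : 0 < γ) (hγ1 : γ < 1) (hθ : 0 < θ) (hC₁ : 0 < C₁) (hC : C₁ < C₂)
    (D : Set ℝ) (hD : ∀ δ ∈ D, 0 < δ)
    (fδ : ℝ → H) (hfδ : ∀ δ ∈ D, ‖fδ δ - f‖ ≤ δ)
    (v : ℝ → H) (α : ℝ → ℝ) (hα : ∀ δ ∈ D, 0 < α δ)
    (hreg : ∀ δ ∈ D, ‖F (v δ) + α δ • v δ - fδ δ‖ ≤ θ * δ)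
    (hdisc : ∀ δ ∈ D,
      C₁ * δ ^ γ ≤ ‖F (v δ) - fδ δ‖ ∧ ‖F (v δ) - fδ δ‖ ≤ C₂ * δ ^ γ) :
    Tendsto (fun δ : ℝ => ‖v δ - y‖) (𝓝[D] 0) (𝓝 0) := by
  have hpow : ∀ s : ℝ, 0 < s → Tendsto (fun δ : ℝ => δ ^ s) (𝓝[D] 0) (𝓝 0) := by
    intro s hs
    have h := (Real.continuousAt_rpow_const (0 : ℝ) s (Or.inr hs.le)).tendsto
    rw [Real.zero_rpow hs.ne'] at h
    exact h.mono_left nhdsWithin_le_nhds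
  -- For small `δ` the regularised residual `θ δ` uses up at most half of the discrepancy
  -- `C₁ δ ^ γ`, so `(C₁ / 2) δ ^ γ` remains as a lower bound for `‖α v‖`.
  let ε : ℝ → ℝ := fun δ => (θ + 1) / (C₁ / 2) * δ ^ (1 - γ)
  have hε : Tendsto ε (𝓝[D] 0) (𝓝 0) := by
    simpa using (hpow (1 - γ) (by linarith)).const_mul ((θ + 1) / (C₁ / 2))
  have hρ : Tendsto (fun δ => (1 + ε δ) / (1 - ε δ) * ‖y‖) (𝓝[D] 0) (𝓝 ‖y‖) := by
    have := ((hε.const_add 1).div (hε.const_sub 1) (by norm_num)).mul_const ‖y‖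
    simpa using this
  refine tendsto_norm_sub_of_norm_le hF_cont hF_mono hy hρ ?_ ?_
  · filter_upwards [self_mem_nhdsWithin, hε.eventually_lt_const one_pos] with δ hδ hε1
    have hδ0 := hD δ hδ
    have hε0 : 0 ≤ ε δ := by
      have := Real.rpow_nonneg hδ0.le (1 - γ)
      positivity
    have hsplit : (θ + 1) * δ = ε δ * (C₁ / 2 * δ ^ γ) := by
      have h : δ ^ (1 - γ) * δ ^ γ = δ := by
        rw [← Real.rpow_add hδ0, sub_add_cancel, Real.rpow_one]
      calc (θ + 1) * δ = (θ + 1) * (δ ^ (1 - γ) * δ ^ γ) := by rw [h]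
        _ = ε δ * (C₁ / 2 * δ ^ γ) := by
          simp only [ε]
          field_simp
    have hpos : 0 ≤ C₁ / 2 * δ ^ γ := by
      have := Real.rpow_nonneg hδ0.le γ
      positivity
    have hlow : C₁ / 2 * δ ^ γ ≤ ‖α δ • v δ‖ := by
      have h1 := norm_sub_norm_le (F (v δ) - fδ δ) (F (v δ) + α δ • v δ - fδ δ)
      have e : F (v δ) - fδ δ - (F (v δ) + α δ • v δ - fδ δ) = -(α δ • v δ) := by abel
      rw [e, norm_neg] at h1
      have h2 : ε δ * (C₁ / 2 * δ ^ γ) ≤ C₁ / 2 * δ ^ γ := mul_le_of_le_one_left hpos hε1.le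
      linarith [hreg δ hδ, (hdisc δ hδ).1]
    refine norm_le_of_inner_sub_le hε0 hε1
      (hF_mono.inner_sub_le (hα δ hδ) hε0 hsplit.le hlow (g := fδ δ) ?_)
    rw [hy.1]
    linarith [hreg δ hδ, hfδ δ hδ]
  · rw [tendsto_iff_norm_sub_tendsto_zero]
    have hid : Tendsto (fun δ : ℝ => δ) (𝓝[D] 0) (𝓝 0) := nhdsWithin_le_nhds
    have hlim : Tendsto (fun δ : ℝ => C₂ * δ ^ γ + δ) (𝓝[D] 0) (𝓝 0) := by
      simpa using ((hpow γ hγ0).const_mul C₂).add hid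
    refine squeeze_zero' (Eventually.of_forall fun δ => norm_nonneg _) ?_ hlim
    filter_upwards [self_mem_nhdsWithin] with δ hδ
    exact (norm_sub_le_norm_sub_add_norm_sub _ (fδ δ) _).trans
      (add_le_add (hdisc δ hδ).2 (hfδ δ hδ))
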